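/- **Model $B_{cd}L$.** Anonymous processes sit on the vertices of a finite simple graph $G$ and run, in synchronous slots and from the same initial state, the same local probabilistic algorithm, which has no knowledge of $G$ (neither of its size, nor of degrees, nor of identities) and whose random choices are independent over vertices and slots. In each slot every process that has not yet completed its computation either beeps or listens. A beeping process learns whether at least one of its neighbours beeped in the same slot (internal collision); a listening process learns only whether at least one neighbour beeped. A process that has completed its computation stays silent. **Algorithm.** Each vertex has variables $state\in\{active,coloured\}$, initially $active$, a real $p$, initially $1/2$, and an integer $colour$, initially $0$. It repeats the following phase, which takes one slot, until $state=coloured$: increment $colour$ by $1$; with probability $p$ become a candidate, and otherwise not; beep if candidate, and otherwise listen. If it is a candidate and there was no internal collision, set $state:=coloured$ (its final colour is the current value of $colour$). Otherwise, if it is not a candidate and heard no beep, replace $p$ by $2p$ if $p<1/2$ (and keep $p$ otherwise); in all remaining cases replace $p$ by $p/2$. **Theorem.** This is a Las Vegas colouring algorithm in the model $B_{cd}L$: on every finite simple graph, in every execution and at every time, two adjacent coloured vertices have different colours, and with probability $1$ all vertices are coloured after finitely many phases. Moreover, there is a function $\varepsilon:\mathbb N\to\mathbb R$ with $\varepsilon(n)=o(n^{-1})$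 as $n\to\infty$ such that for every graph $G$ with $n$ vertices and maximum degree $\Delta$, with probability at least $1-\varepsilon(n)$, all vertices are coloured after at most $76\log_2 n+112\Delta$ phases (slots), and the number of different colours that are used is at most $76\log_2 n+112\Delta$. -/

import Mathlib

open MeasureTheory Filter Asymptotics

universe u

noncomputable section

namespace Beeping

/-- What a vertex perceives in one slot of the beeping model `B_cd L`.
A beeping vertex learns whether some neighbour beeped in the same slot (internal collision);
a listening vertex learns whether at least one neighbour beeped, but not how many. -/
inductive Feedback where
  | beepedAlone
  | internalCollision
  | silence
  | beepHeard

/-- A local probabilistic algorithm for anonymous processes in the model `B_cd L`.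
All vertices run the same algorithm from the same initial state; it has access only to the
local state, to private random numbers and to the feedback of the slots. -/
structure LocalAlgorithm where
  /-- local states -/
  State : Type
  /-- the initial state -/
  start : State
  /-- states in which the vertex has left its loop -/
  done : State → Prop
  /-- local computation before the slot, using a private random number of the unit interval -/
  prepare : State → unitInterval → State
  /-- the prepared states in which the vertex beeps; in the other ones it listens -/
  beeps : State → Prop
  /-- local computation after the slot, according to what was perceived -/
  react : State → Feedback → State

open Classical in
/-- The feedback at `v` when `B` is the set of the vertices that beep in the slot. -/
def feedback {V : Type*} (G : SimpleGraph V) (B : Set V) (v : V) : Feedback :=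
  if v ∈ B then
    if ∃ u, G.Adj v u ∧ u ∈ B then Feedback.internalCollision else Feedback.beepedAlone
  else
    if ∃ u, G.Adj v u ∧ u ∈ B then Feedback.beepHeard else Feedback.silence

namespace LocalAlgorithm

variable (A : LocalAlgorithm) {V : Type*} (G : SimpleGraph V)

/-- The vertices that beep in a phase that starts from `s` with random numbers `r`: a vertex that
has completed its computation neither beeps nor changes its state any more. -/
def beepSet (s : V → A.State) (r : V → unitInterval) : Set V :=
  {v | ¬ A.done (s v) ∧ A.beeps (A.prepare (s v) (r v))}

open Classical in
/-- One synchronous phase, which consists of one slot. -/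
def phase (s : V → A.State) (r : V → unitInterval) : V → A.State := fun v =>
  if A.done (s v) then s v
  else A.react (A.prepare (s v) (r v)) (feedback G (A.beepSet s r) v)

/-- The states of all vertices after `t` phases; `ω i v` is the random number that `v` draws in
phase `i + 1`. -/
def run (ω : ℕ → V → unitInterval) : ℕ → V → A.State
  | 0 => fun _ => A.start
  | t + 1 => A.phase G (run ω t) (ω t)

/-- After `t` phases every vertex has completed its computation. -/
def Terminated (ω : ℕ → V → unitInterval) (t : ℕ) : Prop :=
  ∀ v, A.done (A.run G ω t v)

end LocalAlgorithm

/-- The law of the random numbers: all draws, over all phases and all vertices, are independent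
and uniform on the unit interval. -/
def randomness (V : Type*) [Fintype V] : Measure (ℕ → V → unitInterval) :=
  Measure.infinitePi fun _ : ℕ => Measure.pi fun _ : V => (volume : Measure unitInterval)

/-- The variables of a vertex in the colouring algorithm. -/
structure ColourState where
  /-- `true` for the state "coloured", `false` for the state "active" -/
  coloured : Bool
  candidate : Bool
  p : ℝ
  colour : ℕ

open Classical in
/-- The Las Vegas colouring algorithm. A uniform random number `r` of the unit interval satisfies
`r < p` with probability `p`. -/
def colouringAlgorithm : LocalAlgorithm where
  State := ColourState
  start := { coloured := false, candidate := false, p := 1 / 2, colour := 0 }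
  done s := s.coloured = true
  prepare s r := { s with colour := s.colour + 1, candidate := decide ((r : ℝ) < s.p) }
  beeps s := s.candidate = true
  react s f :=
    if s.candidate = true ∧ f ≠ Feedback.internalCollision then { s with coloured := true }
    else if s.candidate = false ∧ f ≠ Feedback.beepHeard then
      if s.p < 1 / 2 then { s with p := 2 * s.p } else s
    else { s with p := s.p / 2 }

/-- The colour counter of `v` after `t` phases of the colouring algorithm; once `v` is coloured it
is the colour of `v`. -/
def colourAt {V : Type*} (G : SimpleGraph V) (ω : ℕ → V → unitInterval) (t : ℕ) (v : V) : ℕ :=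
  (colouringAlgorithm.run G ω t v : ColourState).colour

/-- `v` is coloured after `t` phases of the colouring algorithm. -/
def IsColoured {V : Type*} (G : SimpleGraph V) (ω : ℕ → V → unitInterval) (t : ℕ) (v : V) :
    Prop :=
  (colouringAlgorithm.run G ω t v : ColourState).coloured = true

/-- The colours taken during the first `t` phases of the colouring algorithm. -/
def coloursUsed {V : Type*} (G : SimpleGraph V) (ω : ℕ → V → unitInterval) (t : ℕ) : Set ℕ :=
  colourAt G ω t '' {v | IsColoured G ω t v}

end Beeping

end

/-!
Adjacent vertices never share a colour, because the colour of a vertex is the number of the slot in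
which it got coloured, and two neighbours that beep in the same slot detect the collision. The rest
of the theorem is a tail bound for the time during which a fixed vertex `v` stays active.

In a slot in which some neighbour of `v` beeps, `v` halves its probability. In every other slot `v`
doubles its probability, or it has the maximal probability `1/2` and gets coloured with chance
`1/2`. Probabilities never exceed `1/2`, so there are at most as many doublings as halvings, and a vertex
that is active after `t` slots satisfies `t ≤ 2 * N + C`, where `N` is the number of beeps of its
neighbours and `C` is the number of slots with a chance of `1/2` (`length_le_of_active`). The number
`C` has a geometric tail, since `2 ^ C` is a supermartingale while `v` is active
(`isSupermartingale_chancePotential`).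

For `N`, every active neighbour `w` of `v` holds a credit `p w / 5 + 1`, and
`exp (N / 22 + total credit)` is a supermartingale (`isSupermartingale_beepPotential`). A neighbour
that hears a beep releases the credit `p w / 10`. Relative to this release, a neighbour that hears
nothing either stays silent and gains at most `3/10 * p w`, or beeps, gets coloured and loses at
least `1`. These outcomes are not independent for different neighbours of `v`, so that the
exponential moment of the total gain over a set `L` of vertices does not factorise. It is bounded
by `exp (11/210 * ∑ w ∈ L, p w)` (`expect_exp_gain_le`), in two steps.

* If the neighbourhoods within `L` have total weight at most `4/3`, the exponential moment of `s`
  times the gain is differentiated in `s`. Flipping a vertex `w` which is silent and hears nothing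
  to beeping multiplies the exponential by at least `exp (-(7/5) - 3/10 * p w)`, so the loss by
  colouring nearly compensates for the gain (`expect_exp_gain_le_of_low`).
* If some `u ∈ L` has a neighbourhood of larger weight, one conditions on whether `u` beeps. If it
  does, its neighbours in `L` leave the gain. If it does not, it gains only if all its neighbours
  are silent, which is unlikely. In both cases the bound for a smaller set applies.

The beeps counted by `N` are absorbed into the law of the beep set by an exponential tilt
(`expect_exp_beeps_add_gain_le`); the constants fit because `1/21 + 11/210 = 1/10`.

An execution is determined by its sequence of beep sets, and the random numbers with a given
sequence form a box, so the law of the sequence is an explicit finite product (`measure_path_eq`).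
Markov's inequality for the two potentials and a union bound over the vertices conclude.
-/

namespace Beeping

section

open scoped Classical

variable {V : Type*} [Fintype V]

/-! ### Random subsets with independent membership -/

/-- The probability that the random set which contains every vertex `v` independently with
probability `q v` is equal to `B`. -/
noncomputable def subsetWeight (q : V → ℝ) (B : Finset V) : ℝ :=
  ∏ v, if v ∈ B then q v else 1 - q v

/-- The expectation of `f` over the random set which contains every vertex `v` independently with
probability `q v`. -/
noncomputable def expect (q : V → ℝ) (f : Finset V → ℝ) : ℝ :=
  ∑ B, subsetWeight q B * f B

/-- The membership probabilities `q`, except that the vertices of `S` are left out. -/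
noncomputable def zeroOn (S : Finset V) (q : V → ℝ) (v : V) : ℝ :=
  if v ∈ S then 0 else q v

theorem subsetWeight_nonneg {q : V → ℝ} (hq : ∀ v, 0 ≤ q v ∧ q v ≤ 1) (B : Finset V) :
    0 ≤ subsetWeight q B := by
  refine Finset.prod_nonneg fun v _ => ?_
  split_ifs
  · exact (hq v).1
  · linarith [(hq v).2]

theorem notMem_of_subsetWeight_ne_zero {q : V → ℝ} {B : Finset V} {v : V} (hv : q v = 0)
    (hB : subsetWeight q B ≠ 0) : v ∉ B := by
  intro h
  exact hB (Finset.prod_eq_zero (Finset.mem_univ v) (by simp [h, hv]))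

omit [Fintype V] in
theorem zeroOn_mem_unit {q : V → ℝ} (hq : ∀ v, 0 ≤ q v ∧ q v ≤ 1) (S : Finset V) (v : V) :
    0 ≤ zeroOn S q v ∧ zeroOn S q v ≤ 1 := by
  unfold zeroOn
  split_ifs
  · norm_num
  · exact hq v

theorem expect_mono {q : V → ℝ} (hq : ∀ v, 0 ≤ q v ∧ q v ≤ 1) {f g : Finset V → ℝ}
    (h : ∀ B, subsetWeight q B ≠ 0 → f B ≤ g B) : expect q f ≤ expect q g := by
  refine Finset.sum_le_sum fun B _ => ?_
  by_cases hB : subsetWeight q B = 0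
  · simp [hB]
  · exact mul_le_mul_of_nonneg_left (h B hB) (subsetWeight_nonneg hq B)

theorem expect_nonneg {q : V → ℝ} (hq : ∀ v, 0 ≤ q v ∧ q v ≤ 1) {f : Finset V → ℝ}
    (h : ∀ B, 0 ≤ f B) : 0 ≤ expect q f :=
  Finset.sum_nonneg fun B _ => mul_nonneg (subsetWeight_nonneg hq B) (h B)

theorem expect_const_mul (q : V → ℝ) (c : ℝ) (f : Finset V → ℝ) :
    expect q (fun B => c * f B) = c * expect q f := by
  simp only [expect, Finset.mul_sum]
  exact Finset.sum_congr rfl fun B _ => by ring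

theorem expect_add (q : V → ℝ) (f g : Finset V → ℝ) :
    expect q (fun B => f B + g B) = expect q f + expect q g := by
  simp only [expect, mul_add, Finset.sum_add_distrib]

theorem expect_sum {ι : Type*} (q : V → ℝ) (s : Finset ι) (f : ι → Finset V → ℝ) :
    expect q (fun B => ∑ i ∈ s, f i B) = ∑ i ∈ s, expect q (f i) := by
  simp only [expect, Finset.mul_sum]
  exact Finset.sum_comm

theorem expect_one (q : V → ℝ) : expect q (fun _ => 1) = 1 := by
  have h := Finset.prod_add q (fun v => 1 - q v) Finset.univ
  simp only [add_sub_cancel, Finset.prod_const_one, Finset.powerset_univ] at h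
  refine Eq.trans (Finset.sum_congr rfl fun B _ => ?_) h.symm
  rw [mul_one, subsetWeight, Finset.prod_ite]
  congr 1
  · exact Finset.prod_congr (by ext; simp) fun _ _ => rfl
  · exact Finset.prod_congr (by ext; simp) fun _ _ => rfl

theorem sum_finset_split (u : V) (f : Finset V → ℝ) :
    ∑ B, f B = ∑ B ∈ (Finset.univ.erase u).powerset, (f B + f (insert u B)) := by
  rw [Finset.sum_add_distrib, ← Finset.sum_powerset_insert (Finset.notMem_erase u _),
    Finset.insert_erase (Finset.mem_univ u), Finset.powerset_univ]

theorem subsetWeight_split (q : V → ℝ) (u : V) (B : Finset V) :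
    subsetWeight q B =
      (if u ∈ B then q u else 1 - q u) *
        ∏ v ∈ Finset.univ.erase u, (if v ∈ B then q v else 1 - q v) :=
  (Finset.mul_prod_erase _ _ (Finset.mem_univ u)).symm

/-- Conditioning on whether `u` belongs to the random set. -/
theorem expect_peel (q : V → ℝ) (u : V) (f : Finset V → ℝ) :
    expect q f = (1 - q u) * expect (zeroOn {u} q) f +
      q u * expect (zeroOn {u} q) (fun B => f (insert u B)) := by
  simp only [expect]
  rw [sum_finset_split u, sum_finset_split u, sum_finset_split u, Finset.mul_sum,
    Finset.mul_sum, ← Finset.sum_add_distrib]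
  refine Finset.sum_congr rfl fun B hB => ?_
  have hu : u ∉ B := fun h => by simpa using Finset.mem_powerset.1 hB h
  have h1 : ∀ B' : Finset V, (∀ v ≠ u, v ∈ B' ↔ v ∈ B) → ∀ r : V → ℝ, (∀ v ≠ u, r v = q v) →
      ∏ v ∈ Finset.univ.erase u, (if v ∈ B' then r v else 1 - r v) =
      ∏ v ∈ Finset.univ.erase u, (if v ∈ B then q v else 1 - q v) := by
    intro B' hB' r hr
    refine Finset.prod_congr rfl fun v hv => ?_
    have hvu := Finset.ne_of_mem_erase hv
    simp [hB' v hvu, hr v hvu]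
  have hz : ∀ v ≠ u, zeroOn {u} q v = q v := fun v hv => by simp [zeroOn, hv]
  have hi : ∀ v ≠ u, v ∈ insert u B ↔ v ∈ B := fun v hv => by simp [hv]
  have hzu : zeroOn {u} q u = 0 := by simp [zeroOn]
  simp only [subsetWeight_split _ u, h1 B (fun _ _ => Iff.rfl) _ hz, h1 _ hi _ hz,
    h1 _ hi q (fun _ _ => rfl), hzu, hu, Finset.mem_insert_self, if_true, if_false]
  ring

/-- Conditioning on the event that the random set avoids `S`. -/
theorem expect_disjoint (q : V → ℝ) (S : Finset V) (f : Finset V → ℝ) :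
    expect q (fun B => if Disjoint B S then f B else 0) =
      (∏ v ∈ S, (1 - q v)) * expect (zeroOn S q) f := by
  simp only [expect, Finset.mul_sum]
  refine Finset.sum_congr rfl fun B _ => ?_
  by_cases hB : Disjoint B S
  · rw [if_pos hB, ← mul_assoc]
    congr 1
    simp only [subsetWeight]
    rw [← Finset.prod_mul_prod_compl S, ← Finset.prod_mul_prod_compl S
      (fun v => if v ∈ B then zeroOn S q v else 1 - zeroOn S q v)]
    have h1 : ∏ v ∈ S, (if v ∈ B then zeroOn S q v else 1 - zeroOn S q v) = 1 := by
      refine Finset.prod_eq_one fun v hv => ?_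
      simp [Finset.disjoint_right.1 hB hv, zeroOn, hv]
    rw [h1, one_mul]
    congr 1
    · exact Finset.prod_congr rfl fun v hv => by simp [Finset.disjoint_right.1 hB hv]
    · refine Finset.prod_congr rfl fun v hv => ?_
      simp [zeroOn, Finset.mem_compl.1 hv]
  · rw [if_neg hB, mul_zero]
    obtain ⟨v, hvB, hvS⟩ := Finset.not_disjoint_iff.1 hB
    have : subsetWeight (zeroOn S q) B = 0 := by
      by_contra h
      exact notMem_of_subsetWeight_ne_zero (v := v) (by simp [zeroOn, hvS]) h hvB
    rw [this]
    ring

/-- An exponential tilt by the number of members in `N` is again a random set with independent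
membership, up to the normalising constant. -/
theorem expect_tilt (q : V → ℝ) (hq : ∀ v, 0 ≤ q v ∧ q v ≤ 1) (N : Finset V) (c : ℝ)
    (f : Finset V → ℝ) :
    expect q (fun B => Real.exp (c * (B ∩ N).card) * f B) =
      (∏ v ∈ N, (1 - q v + q v * Real.exp c)) *
        expect (fun v => if v ∈ N then q v * Real.exp c / (1 - q v + q v * Real.exp c) else q v)
          f := by
  simp only [expect, Finset.mul_sum]
  refine Finset.sum_congr rfl fun B _ => ?_
  rw [← mul_assoc, ← mul_assoc]
  congr 1
  have h1 : Real.exp (c * (B ∩ N).card) = ∏ v, if v ∈ B ∩ N then Real.exp c else 1 := by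
    rw [Finset.prod_ite_mem]
    simp [mul_comm c, Real.exp_nat_mul]
  have h2 : ∏ v ∈ N, (1 - q v + q v * Real.exp c) =
      ∏ v, if v ∈ N then (1 - q v + q v * Real.exp c) else 1 := by
    rw [Finset.prod_ite_mem]
    simp
  rw [h1, h2]
  simp only [subsetWeight]
  rw [← Finset.prod_mul_distrib, ← Finset.prod_mul_distrib]
  refine Finset.prod_congr rfl fun v _ => ?_
  have hpos : 0 < 1 - q v + q v * Real.exp c := by
    rcases (hq v).1.eq_or_lt with h | h
    · simp [← h]
    · have := mul_pos h (Real.exp_pos c)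
      linarith [(hq v).2]
  by_cases hN : v ∈ N <;> by_cases hB : v ∈ B <;> simp [hN, hB] <;> field_simp; ring

/-! ### Exponential moment of the gain of a slot -/

/-- Some neighbour of `w` belongs to the set `B` of beeping vertices. -/
def Heard (G : SimpleGraph V) (B : Finset V) (w : V) : Prop := ∃ u ∈ B, G.Adj w u

/-- The total gain over the vertices of `L` when `B` is the set of the beeping vertices. A vertex
with a beeping neighbour gains nothing; among the other vertices, a beeping one (which gets
coloured) gains `-1` and a silent one (which doubles its probability) gains `3/10` of its
weight `p`. -/
noncomputable def gain (G : SimpleGraph V) (L : Finset V) (p : V → ℝ) (B : Finset V) : ℝ :=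
  ∑ w ∈ L, if Heard G B w then 0 else if w ∈ B then -1 else 3 / 10 * p w

variable {G : SimpleGraph V} {L : Finset V} {p q : V → ℝ}

omit [Fintype V] in
theorem heard_insert {B : Finset V} {u w : V} :
    Heard G (insert u B) w ↔ G.Adj w u ∨ Heard G B w := by
  simp [Heard, or_and_right, exists_or]

omit [Fintype V] in
theorem heard_insert_self {B : Finset V} {u : V} :
    Heard G (insert u B) u ↔ Heard G B u := by
  simp [heard_insert]

omit [Fintype V] in
/-- Flipping a silent vertex without beeping neighbours to beeping loses `1 + 3/10 * p u` at the
vertex and at most the gain of its neighbours. -/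
theorem gain_insert_ge (hp : ∀ w ∈ L, 0 ≤ p w) {B : Finset V} {u : V}
    (huB : u ∉ B) (hu : ¬ Heard G B u) (hpu : 0 ≤ p u) :
    gain G L p B - (1 + 3 / 10 * p u) - 3 / 10 * ∑ w ∈ L with G.Adj u w, p w ≤
      gain G L p (insert u B) := by
  have h1 : ∑ w ∈ L, ((if Heard G B w then 0 else if w ∈ B then -1 else 3 / 10 * p w) -
      (if w = u then 1 + 3 / 10 * p u else 0) - (if G.Adj u w then 3 / 10 * p w else 0)) ≤
      gain G L p (insert u B) := by
    refine Finset.sum_le_sum fun w hw => ?_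
    have hpw := hp w hw
    by_cases hwu : w = u
    · subst hwu
      simp [heard_insert_self, hu, huB]
    · by_cases ha : G.Adj u w
      · have hwB : w ∉ B := fun h => hu ⟨w, h, ha⟩
        by_cases hh : Heard G B w
        · simp [heard_insert, ha.symm, hh, hwu, ha]; linarith
        · simp [heard_insert, ha.symm, hh, hwu, ha, hwB]
      · have ha' : ¬ G.Adj w u := fun h => ha h.symm
        simp [heard_insert, ha, ha', hwu]
  rw [Finset.sum_sub_distrib, Finset.sum_sub_distrib] at h1
  refine le_trans ?_ h1
  have h2 : ∑ w ∈ L, (if w = u then 1 + 3 / 10 * p u else 0) ≤ 1 + 3 / 10 * p u := by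
    rw [Finset.sum_ite_eq']
    split_ifs <;> linarith
  have h3 : ∑ w ∈ L, (if G.Adj u w then 3 / 10 * p w else 0) =
      3 / 10 * ∑ w ∈ L with G.Adj u w, p w := by
    rw [Finset.mul_sum, Finset.sum_filter]
  rw [h3]
  have h4 : gain G L p B =
      ∑ w ∈ L, (if Heard G B w then 0 else if w ∈ B then -1 else 3 / 10 * p w) := rfl
  linarith

theorem exp_neg_seven_fifths : (24 / 100 : ℝ) ≤ Real.exp (-(7 / 5)) := by
  have h1 : Real.exp (1 / 10) ≤ 1 / (1 - 1 / 10) :=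
    Real.exp_bound_div_one_sub_of_interval (by norm_num) (by norm_num)
  have h2 : Real.exp (7 / 5) = Real.exp 1 * Real.exp (1 / 10) ^ 4 := by
    rw [← Real.exp_nat_mul, ← Real.exp_add]; norm_num
  have h3 := Real.exp_one_lt_d9
  have h4 : Real.exp (7 / 5) ≤ 4.15 := by
    rw [h2]
    calc _ ≤ (2.7182818286 : ℝ) * (1 / (1 - 1 / 10)) ^ 4 := by gcongr
      _ ≤ _ := by norm_num
  rw [Real.exp_neg]
  calc (24 / 100 : ℝ) ≤ 4.15⁻¹ := by norm_num
    _ ≤ _ := inv_anti₀ (Real.exp_pos _) h4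

/-- The hypotheses under which the exponential moment of the gain is bounded: `q` is a vector of
probabilities, and on `L` it dominates the weights `p` with a margin in the odds. -/
structure Dominates (L : Finset V) (p q : V → ℝ) : Prop where
  unit : ∀ v, 0 ≤ q v ∧ q v ≤ 1
  nonneg : ∀ w ∈ L, 0 ≤ p w
  le_one : ∀ w ∈ L, p w ≤ 1
  le : ∀ w ∈ L, p w ≤ q w
  odds : ∀ w ∈ L, Real.exp (1 / 22) * p w * (1 - q w) ≤ q w * (1 - p w)

/-- The contribution of one vertex to the derivative of the exponential moment. -/
theorem expect_term_le (h : Dominates L p q) {w : V} (hw : w ∈ L)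
    (hlow : ∑ x ∈ L with G.Adj w x, p x ≤ 4 / 3) {s : ℝ} (hs0 : 0 ≤ s) (hs1 : s ≤ 1) :
    expect q (fun B => (if Heard G B w then 0 else if w ∈ B then -1 else 3 / 10 * p w) *
      Real.exp (s * gain G L p B)) ≤
      11 / 210 * p w * expect q (fun B => Real.exp (s * gain G L p B)) := by
  have hz := zeroOn_mem_unit h.unit {w}
  have hq0 := (h.unit w).1
  have hq1 := (h.unit w).2
  have hp0 := h.nonneg w hw
  have hp1 := h.le_one w hw
  rw [expect_peel q w, expect_peel q w (fun B => Real.exp (s * gain G L p B)), mul_add]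
  have hpos : 0 ≤ 11 / 210 * p w * (q w * expect (zeroOn {w} q)
      (fun B => Real.exp (s * gain G L p (insert w B)))) :=
    mul_nonneg (by linarith) (mul_nonneg hq0 (expect_nonneg hz fun B => (Real.exp_pos _).le))
  refine le_trans ?_ (le_add_of_nonneg_right hpos)
  rw [← expect_const_mul, ← expect_const_mul, ← expect_add, ← expect_const_mul,
    ← expect_const_mul]
  refine expect_mono hz fun B hB => ?_
  have hwB : w ∉ B := notMem_of_subsetWeight_ne_zero (by simp [zeroOn]) hB
  have hE := Real.exp_pos (s * gain G L p B)
  by_cases hh : Heard G B w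
  · simp only [heard_insert_self, hh, if_true]
    have : 0 ≤ 11 / 210 * p w * ((1 - q w) * Real.exp (s * gain G L p B)) :=
      mul_nonneg (by linarith) (mul_nonneg (by linarith) hE.le)
    linarith
  · simp only [heard_insert_self, hh, hwB, if_false, Finset.mem_insert_self, if_true]
    have hg := gain_insert_ge h.nonneg hwB hh hp0
    -- the flip lowers the gain by at most `1 + 3/10 * p w + 3/10 * (4/3) = 7/5 + 3/10 * p w`
    have h1 : Real.exp (s * gain G L p B) * (Real.exp (-(7 / 5)) * (1 - p w)) ≤
        Real.exp (s * gain G L p (insert w B)) := by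
      have : 1 - p w ≤ Real.exp (-(3 / 10 * p w)) := by
        linarith [Real.add_one_le_exp (-(3 / 10 * p w))]
      calc _ ≤ Real.exp (s * gain G L p B) *
            (Real.exp (-(7 / 5)) * Real.exp (-(3 / 10 * p w))) := by gcongr
        _ = Real.exp (s * gain G L p B - (7 / 5 + 3 / 10 * p w)) := by
          rw [← Real.exp_add, ← Real.exp_add]; ring_nf
        _ ≤ _ := by
          refine Real.exp_le_exp.2 ?_
          nlinarith
    have h2 : Real.exp (1 / 22) * p w * (1 - q w) * Real.exp (-(7 / 5)) *
        Real.exp (s * gain G L p B) ≤ q w * Real.exp (s * gain G L p (insert w B)) := by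
      calc _ ≤ q w * (1 - p w) * Real.exp (-(7 / 5)) * Real.exp (s * gain G L p B) := by
            exact mul_le_mul_of_nonneg_right
              (mul_le_mul_of_nonneg_right (h.odds w hw) (Real.exp_pos _).le) hE.le
        _ = q w * (Real.exp (s * gain G L p B) * (Real.exp (-(7 / 5)) * (1 - p w))) := by ring
        _ ≤ _ := by gcongr
    have h3 : (25 / 100 : ℝ) ≤ Real.exp (1 / 22) * Real.exp (-(7 / 5)) := by
      have := Real.add_one_le_exp (1 / 22 : ℝ)
      calc (25 / 100 : ℝ) ≤ (1 / 22 + 1) * (24 / 100) := by norm_num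
        _ ≤ _ := by gcongr; exact exp_neg_seven_fifths
    have h4 : 0 ≤ p w * (1 - q w) * Real.exp (s * gain G L p B) :=
      mul_nonneg (mul_nonneg hp0 (by linarith)) hE.le
    have h5 := mul_le_mul_of_nonneg_right h3 h4
    linarith

/-- The exponential moment of the gain when no vertex of `L` has a neighbourhood of large weight in
`L`: the derivative in the exponent is controlled by flipping single vertices. -/
theorem expect_exp_gain_le_of_low (h : Dominates L p q)
    (hlow : ∀ w ∈ L, ∑ x ∈ L with G.Adj w x, p x ≤ 4 / 3) :
    expect q (fun B => Real.exp (gain G L p B)) ≤ Real.exp (11 / 210 * ∑ w ∈ L, p w) := by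
  set φ : ℝ → ℝ := fun s => expect q (fun B => Real.exp (s * gain G L p B)) with hφ
  set c : ℝ := 11 / 210 * ∑ w ∈ L, p w with hc
  set φ' : ℝ → ℝ := fun s => expect q (fun B => gain G L p B * Real.exp (s * gain G L p B))
    with hφ'
  have hd : ∀ s, HasDerivAt φ (φ' s) s := by
    intro s
    have : HasDerivAt φ (∑ B, subsetWeight q B * (Real.exp (s * gain G L p B) *
        (1 * gain G L p B))) s := by
      refine HasDerivAt.fun_sum fun B _ => ?_
      exact (((hasDerivAt_id s).mul_const _).exp).const_mul _
    convert this using 1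
    simp only [hφ', expect]
    exact Finset.sum_congr rfl fun B _ => by ring
  have hle : ∀ s, 0 ≤ s → s ≤ 1 → φ' s ≤ c * φ s := by
    intro s hs0 hs1
    have : φ' s = ∑ w ∈ L, expect q (fun B =>
        (if Heard G B w then 0 else if w ∈ B then -1 else 3 / 10 * p w) *
          Real.exp (s * gain G L p B)) := by
      rw [← expect_sum, hφ']
      simp only [gain, Finset.sum_mul]
    rw [this, hc, Finset.mul_sum, Finset.sum_mul]
    exact Finset.sum_le_sum fun w hw => expect_term_le h hw (hlow w hw) hs0 hs1
  have hanti : AntitoneOn (fun s => φ s * Real.exp (-(c * s))) (Set.Icc 0 1) := by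
    have hd2 : ∀ s, HasDerivAt (fun s => φ s * Real.exp (-(c * s)))
        (φ' s * Real.exp (-(c * s)) + φ s * (Real.exp (-(c * s)) * (-(c * 1)))) s := by
      intro s
      exact (hd s).mul (((hasDerivAt_id s).const_mul c).neg.exp)
    refine antitoneOn_of_deriv_nonpos (convex_Icc 0 1)
      (fun s _ => (hd2 s).continuousAt.continuousWithinAt)
      (fun s _ => (hd2 s).differentiableAt.differentiableWithinAt) fun s hs => ?_
    rw [interior_Icc] at hs
    rw [(hd2 s).deriv]
    have := mul_le_mul_of_nonneg_right (hle s hs.1.le hs.2.le) (Real.exp_pos (-(c * s))).le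
    linarith
  have h01 := hanti (Set.left_mem_Icc.2 zero_le_one) (Set.right_mem_Icc.2 zero_le_one) zero_le_one
  have h0 : φ 0 = 1 := by simp [hφ, expect_one]
  have h1 : φ 1 = expect q (fun B => Real.exp (gain G L p B)) := by simp [hφ]
  simp only [h0, h1, mul_zero, neg_zero, Real.exp_zero, mul_one] at h01
  rw [Real.exp_neg, ← div_eq_mul_inv, div_le_one (Real.exp_pos _)] at h01
  exact h01

omit [Fintype V] in
theorem Dominates.zeroOn_of_subset (h : Dominates L p q) {L' S : Finset V} (hL : L' ⊆ L)
    (hS : Disjoint L' S) : Dominates L' p (zeroOn S q) := by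
  have hz : ∀ w ∈ L', zeroOn S q w = q w := fun w hw => by
    simp [zeroOn, Finset.disjoint_left.1 hS hw]
  refine ⟨zeroOn_mem_unit h.unit S, fun w hw => h.nonneg w (hL hw),
    fun w hw => h.le_one w (hL hw), fun w hw => ?_, fun w hw => ?_⟩
  · rw [hz w hw]; exact h.le w (hL hw)
  · rw [hz w hw]; exact h.odds w (hL hw)

/-- The numerical inequality behind the conditioning on a vertex of weight `p` and beeping
probability `q`, whose neighbourhood has the large weight `h`. -/
theorem conditioning_bound {P p q h : ℝ} (hp : 0 ≤ p) (hp1 : p ≤ 1) (hpq : p ≤ q)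
    (hh : 4 / 3 ≤ h) :
    (1 - q) * (Real.exp (11 / 210 * (P - p)) +
        (Real.exp (3 / 10 * p) - 1) * Real.exp (3 / 10 * h) *
          (Real.exp (-h) * Real.exp (11 / 210 * (P - p - h)))) +
      q * Real.exp (11 / 210 * (P - p - h)) ≤ Real.exp (11 / 210 * P) := by
  set Z := Real.exp (11 / 210 * (P - p)) with hZ
  have hZ0 : 0 < Z := Real.exp_pos _
  have e1 : Real.exp (11 / 210 * (P - p - h)) = Z * Real.exp (-(11 / 210 * h)) := by
    rw [hZ, ← Real.exp_add]; ring_nf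
  have e2 : Real.exp (3 / 10 * h) * (Real.exp (-h) * Real.exp (11 / 210 * (P - p - h))) =
      Z * Real.exp (-(158 / 210 * h)) := by
    rw [hZ, ← Real.exp_add, ← Real.exp_add, ← Real.exp_add]; ring_nf
  -- `ρ` bounds the effect of a silent neighbourhood, as `158/210 = 1 - 3/10 + 11/210`, and `σ` that
  -- of losing the neighbourhood; the claim reduces to `3/10 * ρ + σ ≤ 1 + 11/210`
  have hρ : Real.exp (-(158 / 210 * h)) ≤ 368 / 1000 := by
    have := Real.exp_neg_one_lt_d9
    have h2 : Real.exp (-(158 / 210 * h)) ≤ Real.exp (-1) := Real.exp_le_exp.2 (by linarith)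
    norm_num at this
    linarith
  have hσ : Real.exp (-(11 / 210 * h)) ≤ 935 / 1000 := by
    have h1 : 1000 / 935 ≤ Real.exp (11 / 210 * h) := by
      have := Real.add_one_le_exp (11 / 210 * h)
      linarith
    rw [Real.exp_neg]
    calc _ ≤ (1000 / 935 : ℝ)⁻¹ := inv_anti₀ (by norm_num) h1
      _ = _ := by norm_num
  set ρ := Real.exp (-(158 / 210 * h))
  set σ := Real.exp (-(11 / 210 * h))
  have hρ0 : 0 < ρ := Real.exp_pos _
  have hg : (1 - q) * (Real.exp (3 / 10 * p) - 1) ≤ 3 / 10 * p := by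
    have h1 : Real.exp (3 / 10 * p) ≤ 1 / (1 - 3 / 10 * p) :=
      Real.exp_bound_div_one_sub_of_interval (by linarith) (by linarith)
    rw [le_div_iff₀ (by linarith)] at h1
    have h2 := Real.add_one_le_exp (3 / 10 * p)
    have h3 : (1 - q) * (Real.exp (3 / 10 * p) - 1) ≤
        (1 - 3 / 10 * p) * (Real.exp (3 / 10 * p) - 1) :=
      mul_le_mul_of_nonneg_right (by linarith) (by linarith)
    linarith
  have hfin : (1 - q) * (1 + (Real.exp (3 / 10 * p) - 1) * ρ) + q * σ ≤ 1 + 11 / 210 * p := by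
    have h1 := mul_le_mul_of_nonneg_right hg hρ0.le
    have h2 : 3 / 10 * p * ρ ≤ 3 / 10 * p * (368 / 1000) :=
      mul_le_mul_of_nonneg_left hρ (by linarith)
    have h3 : p * (65 / 1000) ≤ q * (1 - σ) := by
      apply mul_le_mul <;> linarith
    nlinarith
  calc _ = Z * ((1 - q) * (1 + (Real.exp (3 / 10 * p) - 1) * ρ) + q * σ) := by
        rw [mul_assoc (Real.exp (3 / 10 * p) - 1), e2, e1]; ring
    _ ≤ Z * Real.exp (11 / 210 * p) := by
        refine mul_le_mul_of_nonneg_left (hfin.trans ?_) hZ0.le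
        linarith [Real.add_one_le_exp (11 / 210 * p)]
    _ = _ := by rw [hZ, ← Real.exp_add]; ring_nf

/-- The exponential moment of the gain of a slot. Vertices whose neighbourhood in `L` is heavy are
conditioned upon one after the other: when such a vertex beeps, it takes its neighbourhood out of
the gain, and otherwise it gains only if its whole neighbourhood is silent, which is unlikely. -/
theorem expect_exp_gain_le (h : Dominates L p q) :
    expect q (fun B => Real.exp (gain G L p B)) ≤ Real.exp (11 / 210 * ∑ w ∈ L, p w) := by
  induction L using Finset.strongInduction generalizing q with
  | H L ih =>
  by_cases hlow : ∀ w ∈ L, ∑ x ∈ L with G.Adj w x, p x ≤ 4 / 3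
  · exact expect_exp_gain_le_of_low h hlow
  push Not at hlow
  obtain ⟨u, hu, hheavy⟩ := hlow
  set N := L.filter (fun x => G.Adj u x) with hN
  have huN : u ∉ N := by simp [hN]
  have hNL1 : N ⊆ L.erase u := fun x hx => Finset.mem_erase.2
    ⟨fun e => huN (e ▸ hx), (Finset.mem_filter.1 hx).1⟩
  set L1 := L.erase u with hL1
  set L2 := L1 \ N with hL2
  have hL1L : L1 ⊂ L := Finset.erase_ssubset hu
  have hL2L1 : L2 ⊆ L1 := Finset.sdiff_subset
  have hL2L : L2 ⊂ L := lt_of_le_of_lt hL2L1 hL1L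
  have hdu : Disjoint L1 {u} := by simp [hL1]
  have hd1 : Dominates L1 p (zeroOn {u} q) := h.zeroOn_of_subset hL1L.1 hdu
  have hd2 : Dominates L2 p (zeroOn {u} q) := h.zeroOn_of_subset hL2L.1
    (Finset.disjoint_of_subset_left hL2L1 hdu)
  have hd3 : Dominates L2 p (zeroOn N (zeroOn {u} q)) :=
    hd2.zeroOn_of_subset subset_rfl Finset.sdiff_disjoint
  have i1 := ih L1 hL1L hd1
  have i2 := ih L2 hL2L hd2
  have i3 := ih L2 hL2L hd3
  set P := ∑ w ∈ L, p w with hP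
  set H := ∑ x ∈ N, p x with hH
  have s1 : ∑ w ∈ L1, p w = P - p u := by
    rw [hP, ← Finset.add_sum_erase L p hu]; ring
  have s2 : ∑ w ∈ L2, p w = P - p u - H := by
    rw [← s1, ← Finset.sum_sdiff hNL1]; ring
  rw [s1] at i1
  rw [s2] at i2 i3
  have hp0 := h.nonneg u hu
  have hq0 := (h.unit u).1
  have hq1 := (h.unit u).2
  have hz := zeroOn_mem_unit h.unit {u}
  have hap : 0 ≤ Real.exp (3 / 10 * p u) - 1 := by
    linarith [Real.add_one_le_exp (3 / 10 * p u)]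
  have hsplit : ∀ B, gain G L p B =
      (if Heard G B u then 0 else if u ∈ B then -1 else 3 / 10 * p u) +
        ((∑ w ∈ N, if Heard G B w then 0 else if w ∈ B then -1 else 3 / 10 * p w) +
          gain G L2 p B) := by
    intro B
    rw [gain, ← Finset.add_sum_erase L _ hu, ← Finset.sum_sdiff hNL1, gain, add_comm
      (∑ w ∈ N, _)]
  have hsplit1 : ∀ B, gain G L1 p B =
      (∑ w ∈ N, if Heard G B w then 0 else if w ∈ B then -1 else 3 / 10 * p w) +
          gain G L2 p B := by
    intro B
    rw [gain, ← Finset.sum_sdiff hNL1, gain, add_comm]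
  have hNgain : ∀ B,
      (∑ w ∈ N, if Heard G B w then 0 else if w ∈ B then -1 else 3 / 10 * p w) ≤
        3 / 10 * H := by
    intro B
    rw [hH, Finset.mul_sum]
    refine Finset.sum_le_sum fun w hw => ?_
    have := h.nonneg w (Finset.mem_filter.1 hw).1
    split_ifs <;> linarith
  -- the vertex `u` is silent
  have silent : expect (zeroOn {u} q) (fun B => Real.exp (gain G L p B)) ≤
      Real.exp (11 / 210 * (P - p u)) +
        (Real.exp (3 / 10 * p u) - 1) * Real.exp (3 / 10 * H) *
          (Real.exp (-H) * Real.exp (11 / 210 * (P - p u - H))) := by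
    have hprod : ∏ v ∈ N, (1 - zeroOn {u} q v) ≤ Real.exp (-H) := by
      rw [hH, ← Finset.sum_neg_distrib, Real.exp_sum]
      refine Finset.prod_le_prod (fun v _ => by linarith [(hz v).2]) fun v hv => ?_
      have := hd1.le v (hNL1 hv)
      linarith [Real.add_one_le_exp (-p v)]
    calc _ ≤ expect (zeroOn {u} q) (fun B => Real.exp (gain G L1 p B) +
          (Real.exp (3 / 10 * p u) - 1) * Real.exp (3 / 10 * H) *
            (if Disjoint B N then Real.exp (gain G L2 p B) else 0)) := by
          refine expect_mono hz fun B hB => ?_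
          have huB : u ∉ B := notMem_of_subsetWeight_ne_zero (by simp [zeroOn]) hB
          by_cases hh : Heard G B u
          · rw [hsplit B, hsplit1 B, if_pos hh, zero_add]
            refine le_add_of_nonneg_right (mul_nonneg (mul_nonneg hap (Real.exp_pos _).le) ?_)
            split_ifs
            · exact (Real.exp_pos _).le
            · exact le_rfl
          · have hdis : Disjoint B N := Finset.disjoint_right.2 fun x hx hxB =>
              hh ⟨x, hxB, (Finset.mem_filter.1 hx).2⟩
            rw [hsplit B, if_neg hh, if_neg huB, if_pos hdis, ← hsplit1, Real.exp_add, mul_assoc]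
            have : Real.exp (gain G L1 p B) ≤ Real.exp (3 / 10 * H) * Real.exp (gain G L2 p B) := by
              rw [← Real.exp_add]
              exact Real.exp_le_exp.2 (by rw [hsplit1 B]; linarith [hNgain B])
            nlinarith
      _ ≤ _ := by
          rw [expect_add, expect_const_mul, expect_disjoint]
          refine add_le_add i1 (mul_le_mul_of_nonneg_left ?_
            (mul_nonneg hap (Real.exp_pos _).le))
          exact mul_le_mul hprod i3 (expect_nonneg hd3.unit fun B => (Real.exp_pos _).le)
            (Real.exp_pos _).le
  -- the vertex `u` beeps
  have beep : expect (zeroOn {u} q) (fun B => Real.exp (gain G L p (insert u B))) ≤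
      Real.exp (11 / 210 * (P - p u - H)) := by
    refine le_trans (expect_mono hz fun B hB => Real.exp_le_exp.2 ?_) i2
    rw [hsplit]
    have t1 : (if Heard G (insert u B) u then (0 : ℝ) else if u ∈ insert u B then -1
        else 3 / 10 * p u) ≤ 0 := by
      simp only [Finset.mem_insert_self, if_true]
      split_ifs <;> norm_num
    have t2 : (∑ w ∈ N, if Heard G (insert u B) w then (0 : ℝ) else
        if w ∈ insert u B then -1 else 3 / 10 * p w) = 0 := by
      refine Finset.sum_eq_zero fun w hw => ?_
      rw [if_pos (heard_insert.2 (Or.inl (Finset.mem_filter.1 hw).2.symm))]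
    have t3 : gain G L2 p (insert u B) = gain G L2 p B := by
      refine Finset.sum_congr rfl fun w hw => ?_
      obtain ⟨hw1, hw2⟩ := Finset.mem_sdiff.1 hw
      have hwu : w ≠ u := Finset.ne_of_mem_erase hw1
      have hwa : ¬ G.Adj w u := fun ha =>
        hw2 (Finset.mem_filter.2 ⟨Finset.mem_of_mem_erase hw1, ha.symm⟩)
      simp [heard_insert, hwu, hwa]
    rw [t2, t3]
    linarith
  rw [expect_peel q u]
  refine le_trans (add_le_add (mul_le_mul_of_nonneg_left silent (by linarith))
    (mul_le_mul_of_nonneg_left beep hq0)) ?_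
  exact conditioning_bound hp0 (h.le_one u hu) (h.le u hu) hheavy.le

/-- The exponential moment of the gain together with the number of beeps in `N`, at most the
exponential of the credit `p/10` that every vertex of `L` releases in a slot. -/
theorem expect_exp_beeps_add_gain_le {N L : Finset V} {p : V → ℝ} (hLN : L ⊆ N)
    (hp : ∀ v, 0 ≤ p v ∧ p v ≤ 1) (hL : ∀ v ∈ N, v ∉ L → p v = 0) :
    expect p (fun B => Real.exp (1 / 22 * (B ∩ N).card + gain G L p B)) ≤
      Real.exp (1 / 10 * ∑ w ∈ L, p w) := by
  have hpos : ∀ v, 0 < 1 - p v + p v * Real.exp (1 / 22) := by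
    intro v
    have h1 : 1 ≤ Real.exp (1 / 22) := Real.one_le_exp (by norm_num)
    nlinarith [(hp v).1]
  have h1 : 1 ≤ Real.exp (1 / 22) := Real.one_le_exp (by norm_num)
  simp only [Real.exp_add]
  rw [expect_tilt p hp N (1 / 22)]
  set q : V → ℝ := fun v =>
    if v ∈ N then p v * Real.exp (1 / 22) / (1 - p v + p v * Real.exp (1 / 22)) else p v with hq
  have hdom : Dominates L p q := by
    refine ⟨fun v => ?_, fun w _ => (hp w).1, fun w _ => (hp w).2, fun w hw => ?_,
      fun w hw => ?_⟩
    · simp only [hq]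
      split_ifs
      · refine ⟨div_nonneg (mul_nonneg (hp v).1 (Real.exp_pos _).le) (hpos v).le, ?_⟩
        rw [div_le_one (hpos v)]
        linarith [(hp v).2]
      · exact hp v
    · simp only [hq, if_pos (hLN hw)]
      rw [le_div_iff₀ (hpos w)]
      have : 0 ≤ p w * (1 - p w) * (Real.exp (1 / 22) - 1) :=
        mul_nonneg (mul_nonneg (hp w).1 (by linarith [(hp w).2])) (by linarith)
      nlinarith
    · simp only [hq, if_pos (hLN hw)]
      have hD := (hpos w).ne'
      have : 1 - p w * Real.exp (1 / 22) / (1 - p w + p w * Real.exp (1 / 22)) =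
          (1 - p w) / (1 - p w + p w * Real.exp (1 / 22)) := by
        rw [eq_div_iff hD, sub_mul, div_mul_cancel₀ _ hD]
        ring
      rw [this]
      exact le_of_eq (by ring)
  have hZ : ∏ v ∈ N, (1 - p v + p v * Real.exp (1 / 22)) ≤
      Real.exp (1 / 21 * ∑ w ∈ L, p w) := by
    have hsum : ∑ w ∈ L, p w = ∑ w ∈ N, p w :=
      Finset.sum_subset hLN fun v hv hv' => hL v hv hv'
    rw [hsum, Finset.mul_sum, Real.exp_sum]
    refine Finset.prod_le_prod (fun v _ => (hpos v).le) fun v _ => ?_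
    have h2 : Real.exp (1 / 22) ≤ 1 / (1 - 1 / 22) :=
      Real.exp_bound_div_one_sub_of_interval (by norm_num) (by norm_num)
    have h3 : Real.exp (1 / 22) ≤ 22 / 21 := h2.trans (by norm_num)
    have h4 := mul_le_mul_of_nonneg_left h3 (hp v).1
    linarith [Real.add_one_le_exp (1 / 21 * p v)]
  calc _ ≤ Real.exp (1 / 21 * ∑ w ∈ L, p w) * Real.exp (11 / 210 * ∑ w ∈ L, p w) :=
        mul_le_mul hZ (expect_exp_gain_le hdom)
          (expect_nonneg hdom.unit fun B => (Real.exp_pos _).le) (Real.exp_pos _).le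
    _ = _ := by rw [← Real.exp_add]; ring_nf

end

section

open scoped Classical

variable {V : Type*}

/-! ### Executions as histories of beep sets -/

/-- One phase of the colouring algorithm, as a function of the set `B` of the vertices that beep. -/
noncomputable def slotStep (G : SimpleGraph V) (B : Finset V) (s : V → ColourState) (v : V) :
    ColourState :=
  if (s v).coloured = true then s v
  else if Heard G B v then ⟨false, decide (v ∈ B), (s v).p / 2, (s v).colour + 1⟩
  else if v ∈ B then ⟨true, true, (s v).p, (s v).colour + 1⟩
  else ⟨false, false, if (s v).p < 1 / 2 then 2 * (s v).p else (s v).p, (s v).colour + 1⟩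

/-- The states after the slots with the beep sets `h`, the last slot coming first in the list. -/
noncomputable def stateOf (G : SimpleGraph V) : List (Finset V) → V → ColourState
  | [] => fun _ => ⟨false, false, 1 / 2, 0⟩
  | B :: h => slotStep G B (stateOf G h)

/-- The probability with which a vertex beeps in the next slot. -/
noncomputable def beepProb (s : V → ColourState) (v : V) : ℝ :=
  if (s v).coloured = true then 0 else (s v).p

theorem coloured_stateOf_cons {G : SimpleGraph V} {h : List (Finset V)} {B : Finset V} {v : V}
    (hv : (stateOf G h v).coloured = true) : stateOf G (B :: h) v = stateOf G h v := by
  simp [stateOf, slotStep, hv]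

/-- The colour counter of an active vertex is the number of slots, and a vertex that got coloured
keeps a counter between `1` and the number of slots. -/
theorem colour_stateOf (G : SimpleGraph V) (h : List (Finset V)) (v : V) :
    ((stateOf G h v).coloured = false → (stateOf G h v).colour = h.length) ∧
    ((stateOf G h v).coloured = true →
      1 ≤ (stateOf G h v).colour ∧ (stateOf G h v).colour ≤ h.length) := by
  induction h with
  | nil => simp [stateOf]
  | cons B h ih =>
    cases hc : (stateOf G h v).coloured with
    | true =>
      rw [coloured_stateOf_cons hc, hc]
      have := ih.2 hc
      simp
      omega
    | false =>
      have := ih.1 hc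
      simp only [stateOf, slotStep, hc, List.length_cons]
      split_ifs <;> simp_all

/-- The slot in which a vertex gets coloured is determined by its colour, and two adjacent vertices
never get coloured in the same slot, since each of them would hear the other one. -/
theorem colour_ne_of_adj (G : SimpleGraph V) (h : List (Finset V)) {u v : V} (huv : G.Adj u v)
    (hu : (stateOf G h u).coloured = true) (hv : (stateOf G h v).coloured = true) :
    (stateOf G h u).colour ≠ (stateOf G h v).colour := by
  induction h with
  | nil => simp [stateOf] at hu
  | cons B h ih =>
    cases hcu : (stateOf G h u).coloured <;> cases hcv : (stateOf G h v).coloured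
    · exfalso
      have key : ∀ w, (stateOf G h w).coloured = false →
          (stateOf G (B :: h) w).coloured = true → ¬ Heard G B w ∧ w ∈ B := by
        intro w hw hw'
        simp only [stateOf, slotStep, hw] at hw'
        split_ifs at hw' <;> simp_all
      exact (key u hcu hu).1 ⟨v, (key v hcv hv).2, huv⟩
    · have h1 : (stateOf G (B :: h) u).colour = h.length + 1 := by
        have := (colour_stateOf G h u).1 hcu
        simp only [stateOf, slotStep, hcu]
        split_ifs <;> simp_all
      rw [h1, coloured_stateOf_cons hcv]
      have := ((colour_stateOf G h v).2 hcv).2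
      omega
    · have h1 : (stateOf G (B :: h) v).colour = h.length + 1 := by
        have := (colour_stateOf G h v).1 hcv
        simp only [stateOf, slotStep, hcv]
        split_ifs <;> simp_all
      rw [h1, coloured_stateOf_cons hcu]
      have := ((colour_stateOf G h u).2 hcu).2
      omega
    · rw [coloured_stateOf_cons hcu, coloured_stateOf_cons hcv]
      exact ih hcu hcv

/-- All probabilities are powers of `1/2`, so that doubling a probability below `1/2` never
exceeds `1/2`. -/
theorem exists_p_stateOf_eq (G : SimpleGraph V) (h : List (Finset V)) (v : V) :
    ∃ j : ℕ, (stateOf G h v).p = (1 / 2) ^ (j + 1) := by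
  induction h with
  | nil => exact ⟨0, by simp [stateOf]⟩
  | cons B h ih =>
    obtain ⟨j, hj⟩ := ih
    have hdouble : (stateOf G h v).p < 1 / 2 →
        ∃ i : ℕ, 2 * (stateOf G h v).p = (1 / 2) ^ (i + 1) := by
      intro hlt
      cases j with
      | zero => exact absurd hj (by norm_num; linarith)
      | succ j => exact ⟨j, by rw [hj]; ring⟩
    simp only [stateOf, slotStep]
    split_ifs with h1 h2 h3 h4
    · exact ⟨j, hj⟩
    · exact ⟨j + 1, by simp only [hj]; ring⟩
    · exact ⟨j, hj⟩
    · exact hdouble h4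
    · exact ⟨j, hj⟩

theorem p_stateOf (G : SimpleGraph V) (h : List (Finset V)) (v : V) :
    0 < (stateOf G h v).p ∧ (stateOf G h v).p ≤ 1 / 2 := by
  obtain ⟨j, hj⟩ := exists_p_stateOf_eq G h v
  rw [hj, pow_succ]
  have : (1 / 2 : ℝ) ^ j ≤ 1 := pow_le_one₀ (by norm_num) (by norm_num)
  exact ⟨by positivity, by linarith⟩

theorem beepProb_stateOf (G : SimpleGraph V) (h : List (Finset V)) (v : V) :
    0 ≤ beepProb (stateOf G h) v ∧ beepProb (stateOf G h) v ≤ 1 := by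
  have := p_stateOf G h v
  unfold beepProb
  split_ifs
  · norm_num
  · constructor <;> linarith

variable [Fintype V]

/-- The vertices that beep in a phase which starts from `s` with random numbers `r`. -/
noncomputable def beepers (s : V → ColourState) (r : V → unitInterval) : Finset V :=
  Finset.univ.filter fun v => ¬ (s v).coloured = true ∧ (r v : ℝ) < (s v).p

/-- The beep sets of the first `t` slots of an execution, the last one first. -/
noncomputable def path (G : SimpleGraph V) (ω : ℕ → V → unitInterval) : ℕ → List (Finset V)
  | 0 => []
  | t + 1 => beepers (stateOf G (path G ω t)) (ω t) :: path G ω t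

theorem length_path (G : SimpleGraph V) (ω : ℕ → V → unitInterval) (t : ℕ) :
    (path G ω t).length = t := by
  induction t with
  | zero => rfl
  | succ t ih => simp [path, ih]

theorem feedback_beepSet (G : SimpleGraph V) (s : V → ColourState) (r : V → unitInterval) (v : V) :
    feedback G (colouringAlgorithm.beepSet s r) v =
      if v ∈ beepers s r then
        if Heard G (beepers s r) v then Feedback.internalCollision else Feedback.beepedAlone
      else
        if Heard G (beepers s r) v then Feedback.beepHeard else Feedback.silence := by
  have hmem : ∀ v, v ∈ colouringAlgorithm.beepSet s r ↔ v ∈ beepers s r := by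
    intro v
    simp [LocalAlgorithm.beepSet, beepers, colouringAlgorithm]
  have hheard : (∃ u, G.Adj v u ∧ u ∈ beepers s r) ↔ Heard G (beepers s r) v := by
    simp only [Heard, and_comm]
  simp only [feedback, hmem, hheard]

theorem react_prepare (s : ColourState) (x : unitInterval) (f : Feedback) :
    (colouringAlgorithm.react (colouringAlgorithm.prepare s x) f : ColourState) =
      if decide ((x : ℝ) < s.p) = true ∧ f ≠ Feedback.internalCollision then
        ⟨true, decide ((x : ℝ) < s.p), s.p, s.colour + 1⟩
      else if decide ((x : ℝ) < s.p) = false ∧ f ≠ Feedback.beepHeard then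
        if s.p < 1 / 2 then ⟨s.coloured, decide ((x : ℝ) < s.p), 2 * s.p, s.colour + 1⟩
        else ⟨s.coloured, decide ((x : ℝ) < s.p), s.p, s.colour + 1⟩
      else ⟨s.coloured, decide ((x : ℝ) < s.p), s.p / 2, s.colour + 1⟩ := rfl

theorem phase_eq_slotStep (G : SimpleGraph V) (s : V → ColourState) (r : V → unitInterval) :
    colouringAlgorithm.phase G s r = slotStep G (beepers s r) s := by
  funext v
  by_cases hc : (s v).coloured = true
  · exact (if_pos hc).trans (if_pos hc).symm
  · refine (if_neg hc).trans (Eq.trans ?_ (if_neg hc).symm)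
    refine (react_prepare _ _ _).trans ?_
    have hB : v ∈ beepers s r ↔ (r v : ℝ) < (s v).p := by simp [beepers, hc]
    simp only [Bool.not_eq_true] at hc
    rw [feedback_beepSet]
    simp only [hB, hc]
    by_cases hh : Heard G (beepers s r) v <;> by_cases hr : (r v : ℝ) < (s v).p <;>
      simp [hh, hr]
    · rfl
    · rfl
    · rfl
    · by_cases hp : (s v).p < 2⁻¹
      · exact (if_pos hp).trans (by rw [if_pos hp])
      · exact (if_neg hp).trans (by rw [if_neg hp])

theorem run_eq_stateOf_path (G : SimpleGraph V) (ω : ℕ → V → unitInterval) (t : ℕ) :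
    colouringAlgorithm.run G ω t = stateOf G (path G ω t) := by
  induction t with
  | zero => rfl
  | succ t ih =>
    rw [LocalAlgorithm.run, ih]
    exact phase_eq_slotStep G _ _

/-! ### The law of the history -/

/-- The probability of a history. -/
noncomputable def historyWeight (G : SimpleGraph V) : List (Finset V) → ℝ
  | [] => 1
  | B :: h => subsetWeight (beepProb (stateOf G h)) B * historyWeight G h

theorem historyWeight_nonneg (G : SimpleGraph V) (h : List (Finset V)) :
    0 ≤ historyWeight G h := by
  induction h with
  | nil => exact zero_le_one
  | cons B h ih => exact mul_nonneg (subsetWeight_nonneg (beepProb_stateOf G h) B) ih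

theorem volume_coe_lt {x : ℝ} (h0 : 0 ≤ x) (h1 : x ≤ 1) :
    (volume : Measure unitInterval) {r | (r : ℝ) < x} = ENNReal.ofReal x := by
  have := unitInterval.volume_Iio (x := ⟨x, h0, h1⟩)
  exact this

/-- The random numbers of one slot for which the beep set is `B` form a box. -/
theorem setOf_beepers_eq (G : SimpleGraph V) (h : List (Finset V)) (B : Finset V) :
    MeasurableSet {r | beepers (stateOf G h) r = B} ∧
    (Measure.pi fun _ : V => (volume : Measure unitInterval))
      {r | beepers (stateOf G h) r = B} =
        ENNReal.ofReal (subsetWeight (beepProb (stateOf G h)) B) := by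
  set x := beepProb (stateOf G h) with hx
  have hx01 := beepProb_stateOf G h
  set S : V → Set unitInterval := fun v =>
    if v ∈ B then {r | (r : ℝ) < x v} else {r | (r : ℝ) < x v}ᶜ with hS
  have hmS : ∀ v, MeasurableSet {r : unitInterval | (r : ℝ) < x v} := fun v =>
    measurableSet_lt measurable_subtype_coe measurable_const
  have hbox : {r | beepers (stateOf G h) r = B} = Set.pi Set.univ S := by
    ext r
    have hb : ∀ v, v ∈ beepers (stateOf G h) r ↔ (r v : ℝ) < x v := by
      intro v
      by_cases hc : (stateOf G h v).coloured = true
      · simpa [beepers, hx, beepProb, hc] using (r v).2.1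
      · simp [beepers, hx, beepProb, hc]
    simp only [Set.mem_ofPred_eq, Finset.ext_iff, hb, Set.mem_pi, Set.mem_univ, true_imp_iff, hS]
    refine forall_congr' fun v => ?_
    by_cases hv : v ∈ B <;> simp [hv]
  rw [hbox]
  refine ⟨MeasurableSet.univ_pi fun v => ?_, ?_⟩
  · simp only [hS]
    split_ifs
    · exact hmS v
    · exact (hmS v).compl
  · rw [Measure.pi_pi, subsetWeight, ENNReal.ofReal_prod_of_nonneg]
    · refine Finset.prod_congr rfl fun v _ => ?_
      simp only [hS]
      split_ifs
      · exact volume_coe_lt (hx01 v).1 (hx01 v).2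
      · rw [prob_compl_eq_one_sub (hmS v), volume_coe_lt (hx01 v).1 (hx01 v).2,
          ENNReal.ofReal_sub _ (hx01 v).1, ENNReal.ofReal_one]
    · intro v _
      split_ifs
      · exact (hx01 v).1
      · linarith [(hx01 v).2]

/-- The random numbers with the history `h` form a box, whose side at the slot `i` is given by
`sides G h i`. -/
noncomputable def sides (G : SimpleGraph V) : List (Finset V) → ℕ → Set (V → unitInterval)
  | [] => fun _ => Set.univ
  | B :: h => fun i => if i = h.length then {r | beepers (stateOf G h) r = B} else sides G h i

theorem measurableSet_sides (G : SimpleGraph V) (h : List (Finset V)) (i : ℕ) :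
    MeasurableSet (sides G h i) := by
  induction h with
  | nil => exact MeasurableSet.univ
  | cons B h ih =>
    simp only [sides]
    split_ifs
    · exact (setOf_beepers_eq G h B).1
    · exact ih

theorem setOf_path_eq (G : SimpleGraph V) (h : List (Finset V)) :
    {ω | path G ω h.length = h} = Set.pi (Finset.range h.length) (sides G h) := by
  induction h with
  | nil => simp [path]
  | cons B h ih =>
    ext ω
    have ihω : path G ω h.length = h ↔ ω ∈ Set.pi (Finset.range h.length) (sides G h) := by
      rw [← ih]; rfl
    simp only [Set.mem_ofPred_eq, List.length_cons, path, List.cons.injEq, ihω]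
    simp only [Set.mem_pi, Finset.coe_range, Set.mem_Iio, sides]
    constructor
    · rintro ⟨h1, h2⟩ i hi
      have h3 : path G ω h.length = h := ihω.2 (by simpa using h2)
      rw [h3] at h1
      split_ifs with hih
      · subst hih; exact h1
      · exact h2 i (by omega)
    · intro h1
      have h2 : ∀ i < h.length, ω i ∈ sides G h i := by
        intro i hi
        have := h1 i (by omega)
        rwa [if_neg hi.ne] at this
      refine ⟨?_, h2⟩
      have h3 : path G ω h.length = h := ihω.2 (by simpa using h2)
      have := h1 h.length (Nat.lt_succ_self _)
      rw [if_pos rfl] at this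
      rw [h3]
      exact this

instance isProbabilityMeasure_randomness : IsProbabilityMeasure (randomness V) := by
  unfold randomness
  infer_instance

theorem measure_path_eq (G : SimpleGraph V) (h : List (Finset V)) :
    (randomness V).real {ω | path G ω h.length = h} = historyWeight G h := by
  rw [measureReal_def, setOf_path_eq, randomness,
    Measure.infinitePi_pi _ fun i _ => measurableSet_sides G h i]
  have : ∏ i ∈ Finset.range h.length,
      (Measure.pi fun _ : V => (volume : Measure unitInterval)) (sides G h i) =
        ENNReal.ofReal (historyWeight G h) := by
    induction h with
    | nil => simp [historyWeight]
    | cons B h ih =>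
      rw [List.length_cons, Finset.prod_range_succ, historyWeight,
        ENNReal.ofReal_mul (subsetWeight_nonneg (beepProb_stateOf G h) B), ← ih, mul_comm]
      congr 1
      · simp only [sides, if_true]
        exact (setOf_beepers_eq G h B).2
      · refine Finset.prod_congr rfl fun i hi => ?_
        simp only [sides]
        rw [if_neg (Finset.mem_range.1 hi).ne]
  rw [this, ENNReal.toReal_ofReal (historyWeight_nonneg G h)]

/-- The histories of length `t`. -/
noncomputable def histories (V : Type*) [Fintype V] : ℕ → Finset (List (Finset V))
  | 0 => {[]}
  | t + 1 => (Finset.univ ×ˢ histories V t).image fun x => x.1 :: x.2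

theorem mem_histories {t : ℕ} {h : List (Finset V)} : h ∈ histories V t ↔ h.length = t := by
  induction t generalizing h with
  | zero => simp [histories]
  | succ t ih =>
    cases h with
    | nil => simp [histories]
    | cons B h => simp [histories, ih]

theorem sum_histories_succ (t : ℕ) (f : List (Finset V) → ℝ) :
    ∑ h ∈ histories V (t + 1), f h = ∑ h ∈ histories V t, ∑ B, f (B :: h) := by
  rw [histories, Finset.sum_image (by rintro ⟨B, h⟩ - ⟨B', h'⟩ - he; simpa using he),
    Finset.sum_product_right]

/-- A function of the history whose conditional expectation never increases. -/
def IsSupermartingale (G : SimpleGraph V) (F : List (Finset V) → ℝ) : Prop :=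
  ∀ h, expect (beepProb (stateOf G h)) (fun B => F (B :: h)) ≤ F h

theorem IsSupermartingale.sum_le {G : SimpleGraph V} {F : List (Finset V) → ℝ}
    (hF : IsSupermartingale G F) (t : ℕ) :
    ∑ h ∈ histories V t, historyWeight G h * F h ≤ F [] := by
  induction t with
  | zero => simp [histories, historyWeight]
  | succ t ih =>
    refine le_trans ?_ ih
    rw [sum_histories_succ]
    refine Finset.sum_le_sum fun h _ => ?_
    refine le_trans (le_of_eq ?_) (mul_le_mul_of_nonneg_left (hF h) (historyWeight_nonneg G h))
    simp only [expect, historyWeight, Finset.mul_sum]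
    exact Finset.sum_congr rfl fun B _ => by ring

/-- Markov's inequality for nonnegative supermartingales. -/
theorem IsSupermartingale.measure_le {G : SimpleGraph V} {F : List (Finset V) → ℝ}
    (hF : IsSupermartingale G F) (hF0 : ∀ h, 0 ≤ F h) (Q : List (Finset V) → Prop) (t : ℕ)
    (hQ : ∀ h, h.length = t → Q h → 1 ≤ F h) :
    (randomness V).real {ω | Q (path G ω t)} ≤ F [] := by
  have hsub : {ω | Q (path G ω t)} ⊆
      ⋃ h ∈ (histories V t).filter Q, {ω | path G ω h.length = h} := by
    intro ω hω
    have hl := length_path G ω t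
    simp only [Set.mem_iUnion]
    exact ⟨path G ω t, Finset.mem_filter.2 ⟨mem_histories.2 hl, hω⟩, by
      simp only [Set.mem_ofPred_eq]; rw [hl]⟩
  calc (randomness V).real {ω | Q (path G ω t)}
      ≤ (randomness V).real (⋃ h ∈ (histories V t).filter Q, {ω | path G ω h.length = h}) :=
        measureReal_mono hsub (measure_ne_top _ _)
    _ ≤ ∑ h ∈ (histories V t).filter Q, (randomness V).real {ω | path G ω h.length = h} :=
        measureReal_biUnion_finset_le _ _
    _ ≤ ∑ h ∈ (histories V t).filter Q, historyWeight G h * F h := by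
        refine Finset.sum_le_sum fun h hh => ?_
        obtain ⟨h1, h2⟩ := Finset.mem_filter.1 hh
        rw [measure_path_eq]
        exact le_mul_of_one_le_right (historyWeight_nonneg G h) (hQ h (mem_histories.1 h1) h2)
    _ ≤ ∑ h ∈ histories V t, historyWeight G h * F h :=
        Finset.sum_le_sum_of_subset_of_nonneg (Finset.filter_subset _ _) fun h _ _ =>
          mul_nonneg (historyWeight_nonneg G h) (hF0 h)
    _ ≤ F [] := hF.sum_le t

/-! ### How long a vertex stays active -/

/-- The neighbours of `v`. -/
noncomputable def nbrs (G : SimpleGraph V) (v : V) : Finset V :=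
  Finset.univ.filter fun w => G.Adj v w

/-- The total number of beeps of the neighbours of `v`. -/
noncomputable def beepCount (G : SimpleGraph V) (v : V) : List (Finset V) → ℕ
  | [] => 0
  | B :: h => beepCount G v h + (B ∩ nbrs G v).card

/-- The number of slots in which the active vertex `v` could have been coloured with probability
`1/2`: it has the maximal probability `1/2`, and none of its neighbours beeps. -/
noncomputable def chanceCount (G : SimpleGraph V) (v : V) : List (Finset V) → ℕ
  | [] => 0
  | B :: h => chanceCount G v h +
      if (stateOf G h v).coloured = false ∧ (stateOf G h v).p = 1 / 2 ∧ ¬ Heard G B v then 1 else 0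

theorem heard_iff_inter_nbrs {G : SimpleGraph V} {B : Finset V} {v : V} :
    Heard G B v ↔ 0 < (B ∩ nbrs G v).card := by
  rw [Finset.card_pos]
  constructor
  · rintro ⟨u, hu, ha⟩
    exact ⟨u, by simp [nbrs, hu, ha]⟩
  · rintro ⟨u, hu⟩
    simp only [nbrs, Finset.mem_inter, Finset.mem_filter, Finset.mem_univ, true_and] at hu
    exact ⟨u, hu.1, hu.2⟩

/-- While `v` is active, each of its slots halves its probability after a beep of a neighbour,
doubles it, or is counted by `chanceCount`; there are no more doublings than halvings. -/
theorem length_le_of_active (G : SimpleGraph V) (v : V) (h : List (Finset V))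
    (hv : (stateOf G h v).coloured = false) :
    ∃ j : ℕ, (stateOf G h v).p = (1 / 2) ^ (j + 1) ∧
      h.length + j ≤ 2 * beepCount G v h + chanceCount G v h := by
  induction h with
  | nil => exact ⟨0, by simp [stateOf], by simp⟩
  | cons B h ih =>
    cases hc : (stateOf G h v).coloured with
    | true =>
      rw [coloured_stateOf_cons hc, hc] at hv
      exact absurd hv (by decide)
    | false =>
      obtain ⟨j, hj, hle⟩ := ih hc
      by_cases hh : Heard G B v
      · have hcard := heard_iff_inter_nbrs.1 hh
        refine ⟨j + 1, ?_, ?_⟩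
        · simp only [stateOf, slotStep, hc, hh, if_true, hj]
          simp
          ring
        · simp only [beepCount, chanceCount, List.length_cons]
          omega
      · have hB : v ∉ B := by
          intro hB
          simp [stateOf, slotStep, hc, hh, hB] at hv
        cases j with
        | zero =>
          have hp : (stateOf G h v).p = 1 / 2 := by simpa using hj
          refine ⟨0, ?_, ?_⟩
          · simp [stateOf, slotStep, hc, hh, hB, hp]
          · simp only [beepCount, chanceCount, List.length_cons, hc, hp, hh]
            simp
            omega
        | succ j =>
          have hp : (stateOf G h v).p < 1 / 2 := by
            rw [hj, pow_succ, pow_succ]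
            have : (1 / 2 : ℝ) ^ j ≤ 1 := pow_le_one₀ (by norm_num) (by norm_num)
            linarith
          refine ⟨j, ?_, ?_⟩
          · have : (stateOf G (B :: h) v).p = 2 * (stateOf G h v).p := by
              simp only [stateOf, slotStep, hc, hh, hB, if_false, Bool.false_eq_true]
              rw [if_pos hp]
            rw [this, hj]
            ring
          · simp only [beepCount, chanceCount, List.length_cons]
            omega

/-- The potential `2 ^ chanceCount` of an active vertex. -/
noncomputable def chancePotential (G : SimpleGraph V) (v : V) (h : List (Finset V)) : ℝ :=
  if (stateOf G h v).coloured = true then 0 else 2 ^ chanceCount G v h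

omit [Fintype V] in
theorem chancePotential_nonneg (G : SimpleGraph V) (v : V) (h : List (Finset V)) :
    0 ≤ chancePotential G v h := by
  unfold chancePotential
  split_ifs <;> positivity

theorem isSupermartingale_chancePotential (G : SimpleGraph V) (v : V) :
    IsSupermartingale G (chancePotential G v) := by
  intro h
  have hx := beepProb_stateOf G h
  have bound : ∀ {q : V → ℝ}, (∀ v, 0 ≤ q v ∧ q v ≤ 1) → ∀ f : Finset V → ℝ,
      (∀ B, subsetWeight q B ≠ 0 → f B ≤ chancePotential G v h) →
      expect q f ≤ chancePotential G v h := by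
    intro q hq f hf
    refine (expect_mono hq (g := fun _ => chancePotential G v h * 1)
      fun B hB => (hf B hB).trans (mul_one _).ge).trans ?_
    rw [expect_const_mul, expect_one, mul_one]
  cases hc : (stateOf G h v).coloured with
  | true =>
    refine bound hx _ fun B _ => ?_
    simp [chancePotential, coloured_stateOf_cons hc, hc]
  | false =>
    by_cases hp : (stateOf G h v).p = 1 / 2
    · have hxv : beepProb (stateOf G h) v = 1 / 2 := by simp [beepProb, hc, hp]
      rw [expect_peel _ v, hxv, ← expect_const_mul, ← expect_const_mul, ← expect_add]
      refine bound (zeroOn_mem_unit hx {v}) _ fun B hB => ?_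
      have hvB : v ∉ B := notMem_of_subsetWeight_ne_zero (by simp [zeroOn]) hB
      have h0 : chancePotential G v h = 2 ^ chanceCount G v h := by simp [chancePotential, hc]
      by_cases hh : Heard G B v
      · have hle : ∀ B', Heard G B' v → chancePotential G v (B' :: h) ≤
            chancePotential G v h := by
          intro B' hB'
          simp [chancePotential, chanceCount, hB', hc, stateOf, slotStep]
        have h1 := hle B hh
        have h2 := hle (insert v B) (heard_insert_self.2 hh)
        linarith
      · have h1 : chancePotential G v (B :: h) = 2 * chancePotential G v h := by
          simp [chancePotential, chanceCount, hh, hc, stateOf, slotStep, hvB, hp]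
          ring
        have h2 : chancePotential G v (insert v B :: h) = 0 := by
          simp [chancePotential, heard_insert_self, hh, hc, stateOf, slotStep]
        rw [h1, h2]
        linarith
    · refine bound hx _ fun B _ => ?_
      simp only [chancePotential, chanceCount, hp, hc]
      simp
      split_ifs
      · positivity
      · exact le_rfl

/-- The credit of the neighbours of `v`: `p/5 + 1` for an active vertex with probability `p`. -/
noncomputable def credit (G : SimpleGraph V) (v : V) (h : List (Finset V)) : ℝ :=
  ∑ w ∈ nbrs G v, if (stateOf G h w).coloured = true then 0 else 1 / 5 * (stateOf G h w).p + 1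

/-- The potential that controls the number of beeps in the neighbourhood of `v`. -/
noncomputable def beepPotential (G : SimpleGraph V) (v : V) (h : List (Finset V)) : ℝ :=
  Real.exp (1 / 22 * beepCount G v h + credit G v h)

theorem credit_nonneg (G : SimpleGraph V) (v : V) (h : List (Finset V)) : 0 ≤ credit G v h := by
  refine Finset.sum_nonneg fun w _ => ?_
  have := (p_stateOf G h w).1
  split_ifs <;> linarith

/-- A neighbour that hears a beep halves its probability, which releases the credit `p/10`. -/
theorem credit_cons_le (G : SimpleGraph V) (v : V) (h : List (Finset V)) (B : Finset V) :
    credit G v (B :: h) ≤ credit G v h -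
      1 / 10 * ∑ w ∈ nbrs G v with (stateOf G h w).coloured = false, beepProb (stateOf G h) w +
      gain G ((nbrs G v).filter fun w => (stateOf G h w).coloured = false)
        (beepProb (stateOf G h)) B := by
  unfold credit gain
  rw [Finset.mul_sum, Finset.sum_filter, Finset.sum_filter, ← Finset.sum_sub_distrib,
    ← Finset.sum_add_distrib]
  refine Finset.sum_le_sum fun w _ => ?_
  have hp := (p_stateOf G h w).1
  cases hc : (stateOf G h w).coloured with
  | true => simp [coloured_stateOf_cons hc, hc]
  | false =>
    by_cases hh : Heard G B w
    · simp [stateOf, slotStep, hc, hh, beepProb]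
      linarith
    · by_cases hB : w ∈ B
      · simp [stateOf, slotStep, hc, hh, hB, beepProb]
        linarith
      · simp [stateOf, slotStep, hc, hh, hB, beepProb]
        split_ifs <;> linarith

theorem isSupermartingale_beepPotential (G : SimpleGraph V) (v : V) :
    IsSupermartingale G (beepPotential G v) := by
  intro h
  have hx := beepProb_stateOf G h
  set x := beepProb (stateOf G h) with hxdef
  set L := (nbrs G v).filter fun w => (stateOf G h w).coloured = false with hL
  have hstep : ∀ B, beepPotential G v (B :: h) ≤
      beepPotential G v h * Real.exp (-(1 / 10 * ∑ w ∈ L, x w)) *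
        Real.exp (1 / 22 * (B ∩ nbrs G v).card + gain G L x B) := by
    intro B
    rw [beepPotential, beepPotential, ← Real.exp_add, ← Real.exp_add]
    refine Real.exp_le_exp.2 ?_
    have := credit_cons_le G v h B
    simp only [beepCount]
    push_cast
    linarith
  refine (expect_mono hx fun B _ => hstep B).trans ?_
  rw [expect_const_mul]
  have hmain := expect_exp_beeps_add_gain_le (G := G) (N := nbrs G v) (L := L)
    (Finset.filter_subset _ _) hx fun w hw hwL => by
      have : (stateOf G h w).coloured = true := by
        by_contra hc
        exact hwL (Finset.mem_filter.2 ⟨hw, by simpa using hc⟩)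
      simp [hxdef, beepProb, this]
  calc _ ≤ beepPotential G v h * Real.exp (-(1 / 10 * ∑ w ∈ L, x w)) *
        Real.exp (1 / 10 * ∑ w ∈ L, x w) :=
        mul_le_mul_of_nonneg_left hmain (mul_nonneg (Real.exp_pos _).le (Real.exp_pos _).le)
    _ = beepPotential G v h := by
        rw [mul_assoc, ← Real.exp_add, neg_add_cancel, Real.exp_zero, mul_one]

/-- The tail of the time until `v` is coloured; the parameter `c` splits the slots between the two
potentials. -/
theorem measure_active_le (G : SimpleGraph V) (v : V) (t : ℕ) (c : ℝ) :
    (randomness V).real {ω | (stateOf G (path G ω t) v).coloured = false} ≤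
      (2 : ℝ) ^ (-c) + Real.exp (11 / 10 * (nbrs G v).card - (t - c) / 44) := by
  set F : List (Finset V) → ℝ := fun h =>
    (2 : ℝ) ^ (-c) * chancePotential G v h + Real.exp (-((t - c) / 44)) * beepPotential G v h
    with hF
  have hpow : (0 : ℝ) ≤ (2 : ℝ) ^ (-c) := Real.rpow_nonneg (by norm_num) _
  have hsuper : IsSupermartingale G F := by
    intro h
    rw [hF, expect_add, expect_const_mul, expect_const_mul]
    exact add_le_add
      (mul_le_mul_of_nonneg_left (isSupermartingale_chancePotential G v h) hpow)
      (mul_le_mul_of_nonneg_left (isSupermartingale_beepPotential G v h) (Real.exp_pos _).le)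
  have hnil : F [] = (2 : ℝ) ^ (-c) +
      Real.exp (11 / 10 * (nbrs G v).card - (t - c) / 44) := by
    have h1 : chancePotential G v [] = 1 := by simp [chancePotential, stateOf, chanceCount]
    have h2 : beepPotential G v [] = Real.exp (11 / 10 * (nbrs G v).card) := by
      simp [beepPotential, stateOf, beepCount, credit]
      ring
    rw [hF]
    simp only [h1, h2, mul_one, ← Real.exp_add]
    ring_nf
  rw [← hnil]
  refine hsuper.measure_le (fun h => add_nonneg
    (mul_nonneg hpow (chancePotential_nonneg G v h))
    (mul_nonneg (Real.exp_pos _).le (Real.exp_pos _).le))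
    (fun h => (stateOf G h v).coloured = false) t fun h hl hv => ?_
  obtain ⟨j, -, hj⟩ := length_le_of_active G v h hv
  have hlen : (t : ℝ) ≤ 2 * beepCount G v h + chanceCount G v h := by
    rw [← hl]
    exact_mod_cast le_trans (Nat.le_add_right _ _) hj
  rcases le_or_gt c (chanceCount G v h) with hcc | hcc
  · have h1 : 1 ≤ (2 : ℝ) ^ (-c) * chancePotential G v h := by
      have : chancePotential G v h = (2 : ℝ) ^ (chanceCount G v h : ℝ) := by
        simp [chancePotential, hv]
      rw [this, ← Real.rpow_add (by norm_num)]
      exact Real.one_le_rpow (by norm_num) (by linarith)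
    have h2 : 0 ≤ Real.exp (-((t - c) / 44)) * beepPotential G v h :=
      mul_nonneg (Real.exp_pos _).le (Real.exp_pos _).le
    simp only [hF]
    linarith
  · have h1 : 1 ≤ Real.exp (-((t - c) / 44)) * beepPotential G v h := by
      rw [beepPotential, ← Real.exp_add]
      refine Real.one_le_exp ?_
      have := credit_nonneg G v h
      linarith
    have h2 := mul_nonneg hpow (chancePotential_nonneg G v h)
    simp only [hF]
    linarith

/-! ### Termination and colours -/

theorem isColoured_iff (G : SimpleGraph V) (ω : ℕ → V → unitInterval) (t : ℕ) (v : V) :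
    IsColoured G ω t v ↔ (stateOf G (path G ω t) v).coloured = true := by
  rw [← run_eq_stateOf_path]
  rfl

theorem colourAt_eq (G : SimpleGraph V) (ω : ℕ → V → unitInterval) (t : ℕ) (v : V) :
    colourAt G ω t v = (stateOf G (path G ω t) v).colour := by
  rw [← run_eq_stateOf_path]
  rfl

theorem colourAt_ne_of_adj (G : SimpleGraph V) (ω : ℕ → V → unitInterval) (t : ℕ) {u v : V}
    (huv : G.Adj u v) (hu : IsColoured G ω t u) (hv : IsColoured G ω t v) :
    colourAt G ω t u ≠ colourAt G ω t v := by
  rw [colourAt_eq, colourAt_eq]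
  exact colour_ne_of_adj G _ huv ((isColoured_iff G ω t u).1 hu) ((isColoured_iff G ω t v).1 hv)

theorem ncard_coloursUsed_le (G : SimpleGraph V) (ω : ℕ → V → unitInterval) (t : ℕ) :
    (coloursUsed G ω t).ncard ≤ t := by
  have hsub : coloursUsed G ω t ⊆ (Finset.Icc 1 t : Finset ℕ) := by
    rintro _ ⟨v, hv, rfl⟩
    have h := (colour_stateOf G (path G ω t) v).2 ((isColoured_iff G ω t v).1 hv)
    rw [length_path] at h
    rw [colourAt_eq]
    exact Finset.mem_coe.2 (Finset.mem_Icc.2 h)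
  calc _ ≤ ((Finset.Icc 1 t : Finset ℕ) : Set ℕ).ncard :=
        Set.ncard_le_ncard hsub (Finset.finite_toSet _)
    _ = t := by rw [Set.ncard_coe_finset]; simp

theorem measure_not_terminated_le (G : SimpleGraph V) (t : ℕ) (c : ℝ) :
    (randomness V).real {ω | ¬ colouringAlgorithm.Terminated G ω t} ≤
      ∑ v, ((2 : ℝ) ^ (-c) + Real.exp (11 / 10 * (nbrs G v).card - (t - c) / 44)) := by
  have hsub : {ω | ¬ colouringAlgorithm.Terminated G ω t} ⊆
      ⋃ v ∈ (Finset.univ : Finset V), {ω | (stateOf G (path G ω t) v).coloured = false} := by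
    intro ω hω
    obtain ⟨v, hv⟩ := not_forall.1 hω
    have hv' : ¬ (stateOf G (path G ω t) v).coloured = true := fun h =>
      hv ((isColoured_iff G ω t v).2 h)
    simp only [Set.mem_iUnion]
    exact ⟨v, Finset.mem_univ v, by simpa using hv'⟩
  calc _ ≤ (randomness V).real
        (⋃ v ∈ (Finset.univ : Finset V), {ω | (stateOf G (path G ω t) v).coloured = false}) :=
        measureReal_mono hsub (measure_ne_top _ _)
    _ ≤ ∑ v, (randomness V).real {ω | (stateOf G (path G ω t) v).coloured = false} :=
        measureReal_biUnion_finset_le _ _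
    _ ≤ _ := Finset.sum_le_sum fun v _ => measure_active_le G v t c

theorem ae_terminated (G : SimpleGraph V) :
    ∀ᵐ ω ∂(randomness V), ∃ t : ℕ, colouringAlgorithm.Terminated G ω t := by
  have hlim : Tendsto (fun t : ℕ => ∑ v, ((2 : ℝ) ^ (-((t : ℝ) / 2)) +
      Real.exp (11 / 10 * (nbrs G v).card - (t - (t : ℝ) / 2) / 44))) atTop (nhds 0) := by
    have h2 : Tendsto (fun t : ℕ => (t : ℝ) / 2) atTop atTop :=
      tendsto_natCast_atTop_atTop.atTop_div_const (by norm_num)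
    have key : ∀ v : V, Tendsto (fun t : ℕ => (2 : ℝ) ^ (-((t : ℝ) / 2)) +
        Real.exp (11 / 10 * (nbrs G v).card - (t - (t : ℝ) / 2) / 44)) atTop (nhds (0 + 0)) := by
      intro v
      refine Tendsto.add ?_ ?_
      · simp only [Real.rpow_def_of_pos (by norm_num : (0 : ℝ) < 2)]
        refine Real.tendsto_exp_atBot.comp ?_
        exact (tendsto_neg_atTop_atBot.comp h2).const_mul_atBot (Real.log_pos (by norm_num))
      · refine Real.tendsto_exp_atBot.comp ?_
        refine tendsto_atBot_add_const_left _ _ (tendsto_neg_atTop_atBot.comp ?_)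
        refine Tendsto.atTop_div_const (by norm_num) (h2.congr fun t => by ring)
    simpa using tendsto_finsetSum Finset.univ fun v _ => key v
  rw [ae_iff]
  have hle : (randomness V).real {ω | ¬ ∃ t : ℕ, colouringAlgorithm.Terminated G ω t} ≤ 0 := by
    refine ge_of_tendsto' hlim fun t => ?_
    refine le_trans (measureReal_mono (fun ω hω => ?_) (measure_ne_top _ _))
      (measure_not_terminated_le G t ((t : ℝ) / 2))
    exact not_exists.1 hω t
  exact (measureReal_eq_zero_iff (measure_ne_top _ _)).1 (le_antisymm hle measureReal_nonneg)

theorem card_nbrs_le_maxDegree (G : SimpleGraph V) [DecidableRel G.Adj] (v : V) :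
    (nbrs G v).card ≤ G.maxDegree := by
  refine le_trans (le_of_eq ?_) (G.degree_le_maxDegree v)
  rw [← G.card_neighborFinset_eq_degree]
  congr 1
  ext w
  simp [nbrs]

/-- The failure probability of the time bound. -/
noncomputable def failureBound (n : ℕ) : ℝ :=
  (n : ℝ) ^ (-2 : ℝ) + 2 * (n : ℝ) ^ (-(5 / 4) : ℝ)

theorem isLittleO_failureBound :
    failureBound =o[atTop] (fun n : ℕ => (n : ℝ)⁻¹) := by
  have h : ∀ a : ℝ, a < -1 →
      (fun n : ℕ => (n : ℝ) ^ a) =o[atTop] (fun n : ℕ => (n : ℝ)⁻¹) := by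
    intro a ha
    have h1 : Tendsto (fun n : ℕ => (n : ℝ) ^ (a + 1)) atTop (nhds 0) := by
      have := (tendsto_rpow_neg_atTop (y := -(a + 1)) (by linarith)).comp
        (tendsto_natCast_atTop_atTop (R := ℝ))
      simpa [Function.comp_def] using this
    rw [isLittleO_iff_tendsto' ?_]
    · refine h1.congr' ?_
      filter_upwards [eventually_gt_atTop 0] with n hn
      have : (0 : ℝ) < n := by exact_mod_cast hn
      rw [Real.rpow_add this, Real.rpow_one, div_inv_eq_mul]
    · filter_upwards [eventually_gt_atTop 0] with n hn h0
      have : (0 : ℝ) < n := by exact_mod_cast hn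
      exact absurd h0 (inv_pos.2 this).ne'
  exact (h (-2) (by norm_num)).add ((h (-(5 / 4)) (by norm_num)).const_mul_left 2)

/-- The union bound over the vertices at the time `⌊76 log₂ n + 112 Δ⌋`. -/
theorem measure_not_terminated_le_failureBound (G : SimpleGraph V) {D t : ℕ}
    (hD : ∀ v, (nbrs G v).card ≤ D)
    (ht : 76 * Real.logb 2 (Fintype.card V) + 112 * D ≤ t + 1) :
    (randomness V).real {ω | ¬ colouringAlgorithm.Terminated G ω t} ≤
      failureBound (Fintype.card V) := by
  set n := Fintype.card V with hn
  set l := Real.logb 2 n with hl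
  -- the empty graph is terminated at once; this also avoids `log 0`
  rcases Nat.eq_zero_or_pos n with h0 | hpos
  · have : IsEmpty V := Fintype.card_eq_zero_iff.1 h0
    refine (measure_not_terminated_le G t 0).trans ?_
    rw [Finset.univ_eq_empty, Finset.sum_empty, failureBound]
    positivity
  have hnpos : (0 : ℝ) < n := by exact_mod_cast hpos
  have hn1 : (1 : ℝ) ≤ n := by exact_mod_cast hpos
  have hlog : 0 ≤ Real.log n := Real.log_nonneg hn1
  have hlog2 := Real.log_pos (by norm_num : (1 : ℝ) < 2)
  have e1 : (2 : ℝ) ^ (-(3 * l)) = (n : ℝ) ^ (-3 : ℝ) := by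
    rw [show -(3 * l) = l * (-3) by ring, Real.rpow_mul (by norm_num), hl,
      Real.rpow_logb (by norm_num) (by norm_num) hnpos]
  have e2 : Real.exp (1 / 44 - 73 / 44 * l) ≤ 2 * (n : ℝ) ^ (-(9 / 4) : ℝ) := by
    have h1 : Real.exp (1 / 44) ≤ 2 :=
      (Real.exp_bound_div_one_sub_of_interval (by norm_num) (by norm_num)).trans (by norm_num)
    have h2 : 9 / 4 * Real.log n ≤ 73 / 44 * l := by
      have h3 : l * Real.log 2 = Real.log n := by
        rw [hl, Real.logb, div_mul_cancel₀ _ hlog2.ne']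
      have hl0 : 0 ≤ l := div_nonneg hlog hlog2.le
      have h4 : l * Real.log 2 ≤ l * 0.6931471808 :=
        mul_le_mul_of_nonneg_left Real.log_two_lt_d9.le hl0
      norm_num at h4
      linarith
    rw [Real.rpow_def_of_pos hnpos, sub_eq_add_neg, Real.exp_add]
    refine mul_le_mul h1 (Real.exp_le_exp.2 (by linarith)) (Real.exp_pos _).le (by norm_num)
  have hterm : ∀ v ∈ (Finset.univ : Finset V),
      (2 : ℝ) ^ (-(3 * l)) + Real.exp (11 / 10 * (nbrs G v).card - (t - 3 * l) / 44) ≤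
        (n : ℝ) ^ (-3 : ℝ) + 2 * (n : ℝ) ^ (-(9 / 4) : ℝ) := by
    intro v _
    rw [e1]
    refine add_le_add le_rfl (le_trans (Real.exp_le_exp.2 ?_) e2)
    have h1 : ((nbrs G v).card : ℝ) ≤ D := by exact_mod_cast hD v
    have h2 : (0 : ℝ) ≤ D := Nat.cast_nonneg D
    linarith
  -- `3 * l` slots are left to the chances of probability `1/2`, so that they contribute `n⁻³`; the
  -- other `73 * l + 112 * D` slots pay for the initial credit `11/10 * D` and leave `n ^ (-9/4)`
  refine (measure_not_terminated_le G t (3 * l)).trans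
    ((Finset.sum_le_card_nsmul _ _ _ hterm).trans (le_of_eq ?_))
  rw [Finset.card_univ, ← hn, nsmul_eq_mul, failureBound, mul_add, mul_left_comm]
  congr 1
  · rw [show (-2 : ℝ) = 1 + -3 by norm_num, Real.rpow_add hnpos, Real.rpow_one]
  · rw [show (-(5 / 4) : ℝ) = 1 + -(9 / 4) by norm_num, Real.rpow_add hnpos, Real.rpow_one]

end

end Beeping

theorem mainTheorem1 :
    -- in every execution, adjacent coloured vertices have different colours
    (∀ (V : Type u) [Fintype V] (G : SimpleGraph V) (ω : ℕ → V → unitInterval) (t : ℕ) (u v : V),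
      G.Adj u v → Beeping.IsColoured G ω t u → Beeping.IsColoured G ω t v →
        Beeping.colourAt G ω t u ≠ Beeping.colourAt G ω t v) ∧
    -- almost every execution terminates
    (∀ (V : Type u) [Fintype V] (G : SimpleGraph V),
      ∀ᵐ ω ∂(Beeping.randomness V), ∃ t : ℕ, Beeping.colouringAlgorithm.Terminated G ω t) ∧
    -- with high probability, time and number of colours are at most `76 log₂ n + 112 Δ`
    (∃ ε : ℕ → ℝ, ε =o[atTop] (fun n : ℕ => (n : ℝ)⁻¹) ∧
      ∀ (V : Type u) [Fintype V] (G : SimpleGraph V) [DecidableRel G.Adj],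
        1 - ε (Fintype.card V) ≤
          (Beeping.randomness V).real
            {ω | ∃ t : ℕ,
              (t : ℝ) ≤ 76 * Real.logb 2 (Fintype.card V) + 112 * G.maxDegree ∧
              Beeping.colouringAlgorithm.Terminated G ω t ∧
              ((Beeping.coloursUsed G ω t).ncard : ℝ) ≤
                76 * Real.logb 2 (Fintype.card V) + 112 * G.maxDegree}) := by
  refine ⟨fun V _ G ω t u v huv hu hv => Beeping.colourAt_ne_of_adj G ω t huv hu hv,
    fun V _ G => Beeping.ae_terminated G,
    Beeping.failureBound, Beeping.isLittleO_failureBound, fun V _ G _ => ?_⟩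
  set M := 76 * Real.logb 2 (Fintype.card V) + 112 * (G.maxDegree : ℝ) with hM
  have hM0 : 0 ≤ M := by
    have : 0 ≤ Real.logb 2 (Fintype.card V) :=
      div_nonneg (Real.log_natCast_nonneg _) (Real.log_nonneg (by norm_num))
    positivity
  have htM : ((⌊M⌋₊ : ℕ) : ℝ) ≤ M := Nat.floor_le hM0
  have hbad := Beeping.measure_not_terminated_le_failureBound G
    (Beeping.card_nbrs_le_maxDegree G) (t := ⌊M⌋₊) (Nat.lt_floor_add_one M).le
  have huniv : Set.univ ⊆
      {ω | ∃ t : ℕ, (t : ℝ) ≤ M ∧ Beeping.colouringAlgorithm.Terminated G ω t ∧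
        ((Beeping.coloursUsed G ω t).ncard : ℝ) ≤ M} ∪
      {ω | ¬ Beeping.colouringAlgorithm.Terminated G ω ⌊M⌋₊} := by
    intro ω _
    by_cases hω : Beeping.colouringAlgorithm.Terminated G ω ⌊M⌋₊
    · exact Or.inl ⟨⌊M⌋₊, htM, hω,
        le_trans (by exact_mod_cast Beeping.ncard_coloursUsed_le G ω _) htM⟩
    · exact Or.inr hω
  have h1 := (measureReal_mono (μ := Beeping.randomness V) huniv (measure_ne_top _ _)).trans
    (measureReal_union_le _ _)
  rw [probReal_univ] at h1
  linarith
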